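/- Let $M$ be a monoid. An atom of $M$ is an element $a\neq 1$ such that $a=bc$ implies $b=1$ or $c=1$; for $a\in M$ let $\|a\|$ be the supremum of the lengths of all expressions of $a$ as a product of atoms. $M$ is atomic if it is generated by its atoms and $\|a\|<\infty$ for all $a\in M$. Write $a\le_L b$ if $ac=b$ for some $c\in M$, and $a\le_R b$ if $ca=b$ for some $c\in M$. An atomic monoid $M$ is a Garside monoid with Garside element $\Delta\in M$ if $M$ is finitely generated and left and right cancellative, $(M,\le_L)$ and $(M,\le_R)$ are lattices, for all $a\in M$ one has $a\le_L\Delta$ if and only if $a\le_R\Delta$, and $\{a\in M: a\le_L\Delta\}$ generates $M$. Let $G$ be a nontrivial Garside group, that is, the group of fractions of a Garside monoid $M\subseteq G$ with Garside element $\Delta$, and let $N=\|\Delta\|$. For $g,h\in G$ write $g\le_L h$ if $gc=h$ for some $c\in M$, and put $$\inf(g)=\max\{r\in\mathbb Z:\Delta^r\le_L g\},\qquad \inf\nolimits_s(g)=\max\{\inf(h^{-1}gh):h\in G\},\qquad t_{\inf}(g)=\lim_{n\to\infty}\frac{\inf(g^n)}{n}.$$ **Theorem.** These maxima and this limit exist,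 and for every $g\in G$ the following hold. (i) $t_{\inf}(g)=\max\{\inf_s(g^k)/k : k=1,\dots,N\}$. (ii) For every integer $q$ with $1\le q\le N$, there is an integer $p$ with $t_{\inf}(g)=p/q$ if and only if $\inf_s(g^{qN})=N\inf_s(g^q)$; and whenever $t_{\inf}(g)=p/q$ with $p\in\mathbb Z$, then $p=\inf_s(g^q)$. -/

import Mathlib

namespace Garside

section Monoid

variable {M : Type*} [Monoid M]

/-- Atoms of a monoid: elements `a ≠ 1` such that `a = b * c` implies `b = 1` or `c = 1`. -/
def IsMonoidAtom (a : M) : Prop :=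
  a ≠ 1 ∧ ∀ b c : M, a = b * c → b = 1 ∨ c = 1

/-- `‖a‖`: the supremum (in `ℕ∞`) of the lengths of all expressions of `a` as a product
of atoms. -/
noncomputable def atomNorm (a : M) : ℕ∞ :=
  ⨆ l : {l : List M // (∀ x ∈ l, IsMonoidAtom x) ∧ l.prod = a}, (l.1.length : ℕ∞)

variable (M) in
/-- Atomic monoids: generated by the atoms, with `‖a‖ < ∞` for all `a`. -/
structure IsAtomicMonoid : Prop where
  closure_atoms : Submonoid.closure {a : M | IsMonoidAtom a} = ⊤
  norm_lt_top : ∀ a : M, atomNorm a < ⊤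

/-- `a ≤_L b`: `a * c = b` for some `c`. -/
def LeL (a b : M) : Prop := ∃ c : M, a * c = b

/-- `a ≤_R b`: `c * a = b` for some `c`. -/
def LeR (a b : M) : Prop := ∃ c : M, c * a = b

/-- Any two elements have a greatest lower bound and a least upper bound for the relation `r`. -/
def HasMeetsAndJoins {α : Type*} (r : α → α → Prop) : Prop :=
  ∀ a b : α,
    (∃ m, r m a ∧ r m b ∧ ∀ x, r x a → r x b → r x m) ∧
    (∃ j, r a j ∧ r b j ∧ ∀ x, r a x → r b x → r j x)

/-- `M` is a Garside monoid and `Δ` is a Garside element of it.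
(In a cancellative atomic monoid `LeL` and `LeR` are partial orders automatically.) -/
structure IsGarsideMonoid (Δ : M) : Prop where
  atomic : IsAtomicMonoid M
  fg : Monoid.FG M
  cancel : IsCancelMul M
  lattice_left : HasMeetsAndJoins (LeL : M → M → Prop)
  lattice_right : HasMeetsAndJoins (LeR : M → M → Prop)
  leL_iff_leR : ∀ a : M, LeL a Δ ↔ LeR a Δ
  closure_simple : Submonoid.closure {a : M | LeL a Δ} = ⊤

end Monoid

section Group

variable {M G : Type*} [Monoid M] [Group G]

/-- `G` is the group of fractions of `M`, via the embedding `ι`. -/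
structure IsGroupOfFractions (ι : M →* G) : Prop where
  injective : Function.Injective ι
  exists_frac : ∀ g : G, ∃ a b : M, g = ι a * (ι b)⁻¹

/-- The order `g ≤_L h` on the group: `g * c = h` for some positive element `c`. -/
def GroupLeL (ι : M →* G) (g h : G) : Prop := ∃ c : M, g * ι c = h

/-- The set of integers `r` with `Δ ^ r ≤_L g`. -/
def lowerExponents (ι : M →* G) (Δ : M) (g : G) : Set ℤ :=
  {r : ℤ | GroupLeL ι (ι Δ ^ r) g}

/-- `inf(g) = max {r : Δ ^ r ≤_L g}`. -/
noncomputable def inf (ι : M →* G) (Δ : M) (g : G) : ℤ :=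
  sSup (lowerExponents ι Δ g)

/-- The set of values of `inf` on the conjugacy class of `g`. -/
def conjInfs (ι : M →* G) (Δ : M) (g : G) : Set ℤ :=
  Set.range fun h : G => inf ι Δ (h⁻¹ * g * h)

/-- `inf_s(g)`: the maximum of `inf` on the conjugacy class of `g`. -/
noncomputable def infs (ι : M →* G) (Δ : M) (g : G) : ℤ :=
  sSup (conjInfs ι Δ g)

/-- `t_inf(g)`: the limit of `inf(g ^ n) / n` as `n → ∞`. -/
noncomputable def tInf (ι : M →* G) (Δ : M) (g : G) : ℝ :=
  Filter.limUnder Filter.atTop fun n : ℕ => (inf ι Δ (g ^ n) : ℝ) / (n : ℝ)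

end Group

end Garside

namespace Garside

/-! ### Lengths of factorizations in an atomic monoid. -/

section Monoid

variable {M : Type*} [Monoid M]

/-! Write t for `tInf`. Everything follows from `inf_s(g^j) = ⌊j t⌋` for j ≥ 1 (`infs_pow`) and the
rationality of t with denominator at most N (`exists_mul_tInf_eq_int`).

The heart is `exists_conj_zpow_le`. Suppose Δ^p ≤ g^q, let α = p/q and δ = 1/(N+1), and let m_i be
the meet over all k ≥ 0 of g^k Δ^(-⌊kα + iδ⌋). The m_i descend, and N+1 steps lead from m_0 to m_0
Δ⁻¹. Since ‖Δ‖ = N, some step is trivial. Conjugating by that m_i gives Δ^l ≤ m_i⁻¹ g^j m_i whenever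
l ≤ jα + δ, a gain of δ over the expected bound.

Conversely, conjugation changes `inf` by a bounded amount, so Δ^l below a conjugate of g^j forces l
≤ j t. Hence no integer lies in (jt, jt + δ] for j ≥ 1, and Dirichlet approximation turns this into
a denominator at most N for t. -/

theorem IsAtomicMonoid.exists_atom_list (h : IsAtomicMonoid M) (a : M) :
    ∃ l : List M, (∀ x ∈ l, IsMonoidAtom x) ∧ l.prod = a :=
  Submonoid.exists_list_of_mem_closure (s := {a : M | IsMonoidAtom a})
    (by rw [h.closure_atoms]; trivial)

theorem length_le_atomNorm {a : M} (l : List M) (hl : ∀ x ∈ l, IsMonoidAtom x)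
    (ha : l.prod = a) : (l.length : ℕ∞) ≤ atomNorm a :=
  le_iSup (fun l : {l : List M // (∀ x ∈ l, IsMonoidAtom x) ∧ l.prod = a} =>
    (l.1.length : ℕ∞)) ⟨l, hl, ha⟩

/-- A factorization into nontrivial elements refines to one into atoms. -/
theorem IsAtomicMonoid.exists_atom_list_of_ne_one (h : IsAtomicMonoid M) (l : List M)
    (hl : ∀ x ∈ l, x ≠ 1) :
    ∃ l' : List M, (∀ x ∈ l', IsMonoidAtom x) ∧ l'.prod = l.prod ∧ l.length ≤ l'.length := by
  induction l with
  | nil => exact ⟨[], by simp, rfl, le_rfl⟩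
  | cons a l ih =>
    obtain ⟨l₁, h₁, h₂, h₃⟩ := ih fun x hx => hl x (List.mem_cons_of_mem _ hx)
    obtain ⟨l₂, h₄, h₅⟩ := h.exists_atom_list a
    have hne : l₂ ≠ [] := by
      rintro rfl
      exact hl a List.mem_cons_self h₅.symm
    have hpos : 0 < l₂.length := List.length_pos_of_ne_nil hne
    refine ⟨l₂ ++ l₁, ?_, by simp [h₂, h₅], ?_⟩
    · intro x hx
      rcases List.mem_append.1 hx with hx | hx
      exacts [h₄ x hx, h₁ x hx]
    · rw [List.length_append, List.length_cons]
      omega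

theorem IsAtomicMonoid.length_le_atomNorm (h : IsAtomicMonoid M) (l : List M)
    (hl : ∀ x ∈ l, x ≠ 1) : (l.length : ℕ∞) ≤ atomNorm l.prod := by
  obtain ⟨l', h₁, h₂, h₃⟩ := h.exists_atom_list_of_ne_one l hl
  exact le_trans (by exact_mod_cast h₃) (Garside.length_le_atomNorm l' h₁ h₂)

/-- Otherwise repeating the pair a, b would factor 1 into arbitrarily many nontrivial elements,
against ‖1‖ < ∞. -/
theorem IsAtomicMonoid.eq_one_of_mul_eq_one (h : IsAtomicMonoid M) {a b : M} (hab : a * b = 1) :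
    a = 1 := by
  by_contra ha
  have hb : b ≠ 1 := by
    rintro rfl
    exact ha (by simpa using hab)
  have key : ∀ n : ℕ, (n : ℕ∞) ≤ atomNorm (1 : M) := fun n => by
    have hl := h.length_le_atomNorm (List.replicate n [a, b]).flatten (by
      intro x hx
      obtain ⟨l, hl, hx⟩ := List.mem_flatten.1 hx
      obtain rfl := List.eq_of_mem_replicate hl
      rcases List.mem_pair.1 hx with rfl | rfl <;> assumption)
    have hp : (List.replicate n [a, b]).flatten.prod = 1 := by
      simp [List.prod_flatten, hab]
    rw [hp] at hl
    refine le_trans ?_ hl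
    simp only [List.length_flatten, List.map_replicate, List.sum_replicate, List.length_cons,
      List.length_nil, smul_eq_mul]
    exact_mod_cast (by omega : n ≤ n * (0 + 1 + 1))
  obtain ⟨n, hn⟩ := ENat.ne_top_iff_exists.1 (h.norm_lt_top 1).ne
  have := key (n + 1)
  rw [← hn] at this
  have : n + 1 ≤ n := by exact_mod_cast this
  omega

/-! ### Quasi-centrality of Δ, and meets in the monoid. -/

namespace IsGarsideMonoid

variable {Δ : M} (hM : IsGarsideMonoid Δ)

include hM

/-- For simple a, write ab = Δ; the right divisor b is also a left divisor, ba' = Δ, so aΔ = aba' =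
Δa'. Simple elements generate. -/
theorem exists_mul_garside (c : M) : ∃ c', c * Δ = Δ * c' := by
  have hc : c ∈ Submonoid.closure {a : M | LeL a Δ} := by rw [hM.closure_simple]; trivial
  induction hc using Submonoid.closure_induction with
  | mem a ha =>
    obtain ⟨b, hb⟩ := ha
    obtain ⟨a', ha'⟩ := (hM.leL_iff_leR b).2 ⟨a, hb⟩
    exact ⟨a', by rw [← ha', ← mul_assoc, hb, ha']⟩
  | one => exact ⟨1, by simp⟩
  | mul x y _ _ hx hy =>
    obtain ⟨x', hx⟩ := hx
    obtain ⟨y', hy⟩ := hy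
    exact ⟨x' * y', by rw [mul_assoc, hy, ← mul_assoc, hx, mul_assoc]⟩

theorem exists_garside_mul (c : M) : ∃ c', Δ * c = c' * Δ := by
  have hc : c ∈ Submonoid.closure {a : M | LeL a Δ} := by rw [hM.closure_simple]; trivial
  induction hc using Submonoid.closure_induction with
  | mem a ha =>
    obtain ⟨b, hb⟩ := (hM.leL_iff_leR a).1 ha
    obtain ⟨a', ha'⟩ := (hM.leL_iff_leR b).1 ⟨a, hb⟩
    exact ⟨a', by rw [← ha', mul_assoc, hb, ha']⟩
  | one => exact ⟨1, by simp⟩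
  | mul x y _ _ hx hy =>
    obtain ⟨x', hx⟩ := hx
    obtain ⟨y', hy⟩ := hy
    exact ⟨x' * y', by rw [← mul_assoc, hx, mul_assoc, hy, mul_assoc]⟩

theorem exists_mul_garside_pow (c : M) (n : ℕ) : ∃ c', c * Δ ^ n = Δ ^ n * c' := by
  induction n with
  | zero => exact ⟨c, by simp⟩
  | succ n ih =>
    obtain ⟨c', hc'⟩ := ih
    obtain ⟨d, hd⟩ := hM.exists_mul_garside c'
    exact ⟨d, by rw [pow_succ, ← mul_assoc, hc', mul_assoc, hd, mul_assoc]⟩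

theorem exists_garside_pow_mul (c : M) (n : ℕ) : ∃ c', Δ ^ n * c = c' * Δ ^ n := by
  induction n with
  | zero => exact ⟨c, by simp⟩
  | succ n ih =>
    obtain ⟨c', hc'⟩ := ih
    obtain ⟨d, hd⟩ := hM.exists_garside_mul c'
    exact ⟨d, by rw [pow_succ', mul_assoc, hc', ← mul_assoc, hd, mul_assoc]⟩

theorem exists_leL_garside_pow (b : M) : ∃ n : ℕ, LeL b (Δ ^ n) := by
  have hb : b ∈ Submonoid.closure {a : M | LeL a Δ} := by rw [hM.closure_simple]; trivial
  induction hb using Submonoid.closure_induction with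
  | mem a ha => exact ⟨1, by simpa using ha⟩
  | one => exact ⟨0, 1, by simp⟩
  | mul x y _ _ hx hy =>
    obtain ⟨n, c, hx⟩ := hx
    obtain ⟨k, d, hy⟩ := hy
    obtain ⟨c', hc'⟩ := hM.exists_mul_garside_pow c k
    refine ⟨n + k, d * c', ?_⟩
    rw [mul_assoc, ← mul_assoc y, hy, ← hc', ← mul_assoc, hx, pow_add]

theorem garside_pow_ne_one [Nontrivial M] {n : ℕ} (hn : n ≠ 0) : Δ ^ n ≠ 1 := by
  intro h
  obtain ⟨k, rfl⟩ := Nat.exists_eq_succ_of_ne_zero hn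
  have hΔ : Δ = 1 := hM.atomic.eq_one_of_mul_eq_one (by rw [← pow_succ']; exact h)
  have htop := hM.closure_simple
  have hbot : Submonoid.closure {a : M | LeL a Δ} ≤ ⊥ := by
    rw [Submonoid.closure_le]
    rintro a ⟨c, hc⟩
    exact hM.atomic.eq_one_of_mul_eq_one (hc.trans hΔ)
  obtain ⟨x, hx⟩ := exists_ne (1 : M)
  exact hx (hbot (by rw [htop]; trivial))

theorem atomNorm_pos [Nontrivial M] {N : ℕ} (hN : atomNorm Δ = (N : ℕ∞)) : 0 < N := by
  have h := hM.atomic.length_le_atomNorm [Δ] (by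
    simpa using hM.garside_pow_ne_one one_ne_zero)
  rw [List.prod_singleton, hN] at h
  have : 1 ≤ N := by exact_mod_cast h
  exact this

/-- Left multiplication preserves meets. -/
theorem leL_mul_of_meet {a b m : M} (hm : ∀ x, LeL x a → LeL x b → LeL x m) (c : M) {x : M}
    (hxa : LeL x (c * a)) (hxb : LeL x (c * b)) : LeL x (c * m) := by
  have := hM.cancel
  obtain ⟨d, hda, hdb, hd⟩ := (hM.lattice_left (c * a) (c * b)).1
  -- The meet of ca and cb is a multiple ce; cancelling c shows that e divides a and b, hence m.
  obtain ⟨e, rfl⟩ := hd c ⟨a, rfl⟩ ⟨b, rfl⟩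
  obtain ⟨u, hu⟩ := hda
  obtain ⟨v, hv⟩ := hdb
  rw [mul_assoc] at hu hv
  obtain ⟨w, hw⟩ := hm e ⟨u, mul_left_cancel hu⟩ ⟨v, mul_left_cancel hv⟩
  obtain ⟨y, hy⟩ := hd x hxa hxb
  exact ⟨y * w, by rw [← mul_assoc, hy, mul_assoc, hw]⟩

end IsGarsideMonoid

end Monoid

/-! ### The order on the group of fractions. -/

section Group

variable {M G : Type*} [Monoid M] [Group G] {ι : M →* G}

namespace GroupLeL

theorem refl (x : G) : GroupLeL ι x x := ⟨1, by simp⟩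

theorem trans {x y z : G} (h₁ : GroupLeL ι x y) (h₂ : GroupLeL ι y z) : GroupLeL ι x z := by
  obtain ⟨c, rfl⟩ := h₁
  obtain ⟨d, rfl⟩ := h₂
  exact ⟨c * d, by rw [map_mul, mul_assoc]⟩

theorem mul_left (g : G) {x y : G} (h : GroupLeL ι x y) : GroupLeL ι (g * x) (g * y) := by
  obtain ⟨c, rfl⟩ := h
  exact ⟨c, mul_assoc _ _ _⟩

end GroupLeL

variable {Δ : M} (hM : IsGarsideMonoid Δ)

include hM

/-- Quasi-centrality makes the left-invariant order invariant under right multiplication by powers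
of Δ too. -/
theorem GroupLeL.mul_zpow {x y : G} (h : GroupLeL ι x y) (r : ℤ) :
    GroupLeL ι (x * ι Δ ^ r) (y * ι Δ ^ r) := by
  obtain ⟨c, rfl⟩ := h
  obtain ⟨n, rfl | rfl⟩ := r.eq_nat_or_neg
  · obtain ⟨c', hc'⟩ := hM.exists_mul_garside_pow c n
    refine ⟨c', ?_⟩
    rw [zpow_natCast, ← map_pow, mul_assoc, mul_assoc, ← map_mul, ← map_mul, hc']
  · obtain ⟨c', hc'⟩ := hM.exists_garside_pow_mul c n
    refine ⟨c', ?_⟩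
    have h : ι Δ ^ n * ι c = ι c' * ι Δ ^ n := by rw [← map_pow, ← map_mul, hc', map_mul]
    rw [zpow_neg, zpow_natCast, mul_assoc, mul_assoc, mul_right_inj, eq_mul_inv_iff_mul_eq,
      mul_assoc, ← h, inv_mul_cancel_left]

omit hM in
theorem groupLeL_zpow_of_le {r s : ℤ} (h : r ≤ s) : GroupLeL ι (ι Δ ^ r) (ι Δ ^ s) := by
  obtain ⟨n, rfl⟩ := Int.exists_add_of_le h
  exact ⟨Δ ^ n, by rw [map_pow, zpow_add, zpow_natCast]⟩

theorem GroupLeL.zpow_pow {x : G} {r : ℤ} (h : GroupLeL ι (ι Δ ^ r) x) (n : ℕ) :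
    GroupLeL ι (ι Δ ^ (n * r)) (x ^ n) := by
  induction n with
  | zero => simpa using GroupLeL.refl (ι := ι) 1
  | succ n ih =>
    have h₁ := h.mul_zpow hM (n * r)
    have h₂ := ih.mul_left x
    rw [← zpow_add, ← pow_succ'] at *
    convert h₁.trans h₂ using 2
    push_cast
    ring

theorem GroupLeL.pow_zpow {x : G} {s : ℤ} (h : GroupLeL ι x (ι Δ ^ s)) (n : ℕ) :
    GroupLeL ι (x ^ n) (ι Δ ^ (n * s)) := by
  induction n with
  | zero => simpa using GroupLeL.refl (ι := ι) 1
  | succ n ih =>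
    have h₁ := h.mul_zpow hM (n * s)
    have h₂ := ih.mul_left x
    rw [← zpow_add] at h₁
    rw [← pow_succ'] at h₂
    convert h₂.trans h₁ using 2
    push_cast
    ring

theorem exists_groupLeL_zpow (hG : IsGroupOfFractions ι) (g : G) :
    ∃ n : ℕ, GroupLeL ι (ι Δ ^ (-n : ℤ)) g := by
  obtain ⟨a, b, rfl⟩ := hG.exists_frac g
  obtain ⟨n, e, he⟩ := hM.exists_leL_garside_pow b
  refine ⟨n, ?_⟩
  have h : GroupLeL ι 1 (ι (a * e)) := ⟨a * e, one_mul _⟩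
  have h' := h.mul_zpow hM (-n)
  rw [one_mul] at h'
  convert h' using 1
  rw [zpow_neg, zpow_natCast, ← map_pow, ← he, map_mul, map_mul]
  group

theorem exists_groupLeL_zpow_right (hG : IsGroupOfFractions ι) (g : G) :
    ∃ n : ℕ, GroupLeL ι g (ι Δ ^ (n : ℤ)) := by
  obtain ⟨n, h⟩ := exists_groupLeL_zpow hM hG g⁻¹
  refine ⟨n, ?_⟩
  have h' := (h.mul_zpow hM n).mul_left g
  simpa using h'

omit hM in
theorem IsGroupOfFractions.nontrivial [Nontrivial G] (hG : IsGroupOfFractions ι) :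
    Nontrivial M := by
  by_contra h
  rw [not_nontrivial_iff_subsingleton] at h
  obtain ⟨g, hg⟩ := exists_ne (1 : G)
  obtain ⟨a, b, rfl⟩ := hG.exists_frac g
  rw [Subsingleton.elim a b, mul_inv_cancel] at hg
  exact hg rfl

theorem le_of_groupLeL_zpow [Nontrivial G] (hG : IsGroupOfFractions ι) {r s : ℤ}
    (h : GroupLeL ι (ι Δ ^ r) (ι Δ ^ s)) : r ≤ s := by
  by_contra! hlt
  have := hG.nontrivial
  obtain ⟨c, hc⟩ := h
  obtain ⟨n, rfl⟩ := Int.exists_add_of_le hlt.le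
  have hn : n ≠ 0 := by
    rintro rfl
    simp at hlt
  rw [zpow_add, mul_assoc, zpow_natCast, mul_eq_left, ← map_pow, ← map_mul] at hc
  have h1 : Δ ^ n * c = 1 := hG.injective (by rw [hc, map_one])
  exact hM.garside_pow_ne_one hn (hM.atomic.eq_one_of_mul_eq_one h1)

/-- Binary meets in the group of fractions. -/
theorem exists_group_meet (hG : IsGroupOfFractions ι) (x y : G) :
    ∃ m, GroupLeL ι m x ∧ GroupLeL ι m y ∧
      ∀ z, GroupLeL ι z x → GroupLeL ι z y → GroupLeL ι z m := by
  have key : ∀ z : G, ∃ n : ℕ, ∃ c : M, ι (Δ ^ n) * z = ι c := fun z => by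
    obtain ⟨n, c, hc⟩ := exists_groupLeL_zpow hM hG z
    exact ⟨n, c, by rw [← hc, zpow_neg, zpow_natCast, map_pow, mul_inv_cancel_left]⟩
  obtain ⟨n₁, a₁, h₁⟩ := key x
  obtain ⟨n₂, a₂, h₂⟩ := key y
  have hx : ι (Δ ^ (n₁ + n₂)) * x = ι (Δ ^ n₂ * a₁) := by
    rw [add_comm, pow_add, map_mul, mul_assoc, h₁, map_mul]
  have hy : ι (Δ ^ (n₁ + n₂)) * y = ι (Δ ^ n₁ * a₂) := by
    rw [pow_add, map_mul, mul_assoc, h₂, map_mul]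
  generalize n₁ + n₂ = n at hx hy
  generalize Δ ^ n₂ * a₁ = a at hx
  generalize Δ ^ n₁ * a₂ = b at hy
  have hx' : x = (ι (Δ ^ n))⁻¹ * ι a := by rw [← hx, inv_mul_cancel_left]
  have hy' : y = (ι (Δ ^ n))⁻¹ * ι b := by rw [← hy, inv_mul_cancel_left]
  obtain ⟨d, ⟨u, hu⟩, ⟨v, hv⟩, hd⟩ := (hM.lattice_left a b).1
  refine ⟨(ι (Δ ^ n))⁻¹ * ι d, ⟨u, ?_⟩, ⟨v, ?_⟩, ?_⟩
  · rw [mul_assoc, ← map_mul, hu, hx']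
  · rw [mul_assoc, ← map_mul, hv, hy']
  -- The competitor z may need a further power Δ^k to become positive, so the meet d must survive
  -- left multiplication by Δ^k.
  · rintro z ⟨s, hs⟩ ⟨t, ht⟩
    obtain ⟨k, c, hc⟩ := key z
    have hz : ι (Δ ^ (k + n)) * z = ι (Δ ^ n * c) := by
      rw [add_comm, pow_add, map_mul, mul_assoc, hc, map_mul]
    have hsx : LeL (Δ ^ n * c) (Δ ^ k * a) := ⟨s, hG.injective (by
      rw [map_mul, ← hz, mul_assoc, hs, pow_add, map_mul, mul_assoc, hx, map_mul])⟩
    have hty : LeL (Δ ^ n * c) (Δ ^ k * b) := ⟨t, hG.injective (by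
      rw [map_mul, ← hz, mul_assoc, ht, pow_add, map_mul, mul_assoc, hy, map_mul])⟩
    obtain ⟨w, hw⟩ := hM.leL_mul_of_meet hd _ hsx hty
    refine ⟨w, ?_⟩
    have hw' := congrArg ι hw
    rw [map_mul, ← hz, map_mul, pow_add, map_mul, mul_assoc, mul_assoc, mul_right_inj] at hw'
    rw [← hw', inv_mul_cancel_left]

theorem exists_group_meet_family (hG : IsGroupOfFractions ι) (x : ℕ → G) (n : ℕ) :
    ∃ m, (∀ k < n + 1, GroupLeL ι m (x k)) ∧
      ∀ z, (∀ k < n + 1, GroupLeL ι z (x k)) → GroupLeL ι z m := by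
  induction n with
  | zero =>
    refine ⟨x 0, fun k hk => ?_, fun z hz => hz 0 one_pos⟩
    obtain rfl : k = 0 := by omega
    exact GroupLeL.refl _
  | succ n ih =>
    obtain ⟨m, h₁, h₂⟩ := ih
    obtain ⟨m', h₃, h₄, h₅⟩ := exists_group_meet hM hG m (x (n + 1))
    refine ⟨m', fun k hk => ?_, fun z hz => h₅ z (h₂ z fun k hk => hz k (by omega))
      (hz _ (by omega))⟩
    rcases Nat.lt_succ_iff_lt_or_eq.1 hk with hk | rfl
    exacts [h₃.trans (h₁ k hk), h₄]

/-! ### The descending chain of meets. -/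

/-- A descending chain of length `N + 1` from `m 0` to at least `m 0 * Δ⁻¹` has a repetition. -/
theorem exists_chain_repetition (hG : IsGroupOfFractions ι) {N : ℕ}
    (hN : atomNorm Δ = (N : ℕ∞)) (m : ℕ → G) (hm : ∀ i, GroupLeL ι (m (i + 1)) (m i))
    (hend : GroupLeL ι (m 0 * (ι Δ)⁻¹) (m (N + 1))) :
    ∃ i, GroupLeL ι (m i) (m (i + 1)) := by
  by_contra! hcon
  choose c hc using hm
  have hc1 : ∀ i, c i ≠ 1 := fun i hi => hcon i ⟨1, by rw [← hc i, hi]; simp⟩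
  have key : ∀ n : ℕ, ∃ l : List M, l.length = n ∧ (∀ x ∈ l, x ≠ 1) ∧
      m n * ι l.prod = m 0 := fun n => by
    induction n with
    | zero => exact ⟨[], rfl, by simp, by simp⟩
    | succ n ih =>
      obtain ⟨l, h₁, h₂, h₃⟩ := ih
      refine ⟨c n :: l, by simp [h₁], ?_, ?_⟩
      · intro x hx
        rcases List.mem_cons.1 hx with rfl | hx
        exacts [hc1 n, h₂ x hx]
      · rw [List.prod_cons, map_mul, ← mul_assoc, hc, h₃]
  obtain ⟨l, h₁, h₂, h₃⟩ := key (N + 1)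
  obtain ⟨d, hd⟩ := hend
  have hprod : d * l.prod = Δ := hG.injective (by
    rw [← hd, mul_assoc, mul_assoc, mul_eq_left, inv_mul_eq_one] at h₃
    rw [map_mul, h₃])
  obtain ⟨l', h₄, h₅⟩ := hM.atomic.exists_atom_list d
  have hlen := hM.atomic.length_le_atomNorm (l' ++ l) (by
    intro x hx
    rcases List.mem_append.1 hx with hx | hx
    exacts [(h₄ x hx).1, h₂ x hx])
  rw [List.prod_append, h₅, hprod, hN] at hlen
  have : (l' ++ l).length ≤ N := by exact_mod_cast hlen
  rw [List.length_append] at this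
  omega

/-- If `Δ ^ p ≤_L g ^ q`, then a single conjugate of `g` has all its powers `j` bounded below by
the powers of `Δ` with exponents up to `j * (p / q) + 1 / (N + 1)`. -/
theorem exists_conj_zpow_le (hG : IsGroupOfFractions ι) {N : ℕ} (hN : atomNorm Δ = (N : ℕ∞))
    {g : G} {p : ℤ} {q : ℕ} (hq : 0 < q) (h : GroupLeL ι (ι Δ ^ p) (g ^ q)) :
    ∃ m : G, ∀ (j : ℕ) (l : ℤ), (l : ℝ) ≤ j * ((p : ℝ) / q) + 1 / (N + 1) →
      GroupLeL ι (ι Δ ^ l) (m⁻¹ * g ^ j * m) := by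
  set α : ℝ := (p : ℝ) / q with hα
  set δ : ℝ := 1 / (N + 1) with hδ
  have hN1 : (N + 1 : ℝ) ≠ 0 := by positivity
  have hqα : (q : ℝ) * α = p := by
    rw [hα]
    field_simp
  have hδpos : 0 < δ := by positivity
  let f : ℕ → ℕ → ℤ := fun i k => ⌊(k : ℝ) * α + i * δ⌋
  let x : ℕ → ℕ → G := fun i k => g ^ k * ι Δ ^ (-f i k)
  have hq' : q - 1 + 1 = q := by omega
  choose m hmle hmglb using fun i => exists_group_meet_family hM hG (x i) (q - 1)
  rw [hq'] at hmle hmglb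
  have hmle' : ∀ i k, GroupLeL ι (m i) (x i k) := fun i k => by
    induction k using Nat.strong_induction_on with
    | _ k ih =>
      rcases lt_or_ge k q with hk | hk
      · exact hmle i k hk
      · obtain ⟨k', rfl⟩ := Nat.exists_eq_add_of_le' hk
        refine (ih k' (by omega)).trans ?_
        -- As qα = p, the exponent is periodic up to p, and Δ^p ≤ g^q gives `x i k' ≤ x i (k' + q)`.
        -- So the meet over one period bounds every k.
        have hf : f i (k' + q) = p + f i k' := by
          simp only [f]
          rw [add_comm p, ← Int.floor_add_intCast, ← hqα]
          push_cast
          congr 1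
          ring
        have h₁ := (h.mul_zpow hM (-f i (k' + q))).mul_left (g ^ k')
        rw [← zpow_add, ← mul_assoc, ← pow_add] at h₁
        convert h₁ using 3
        rw [hf]
        ring
  have hmono : ∀ i, GroupLeL ι (m (i + 1)) (m i) := fun i => by
    refine hmglb i _ fun k _ => (hmle' (i + 1) k).trans ?_
    refine (groupLeL_zpow_of_le (neg_le_neg (Int.floor_le_floor ?_))).mul_left _
    push_cast
    linarith
  have hend : GroupLeL ι (m 0 * (ι Δ)⁻¹) (m (N + 1)) := by
    refine hmglb _ _ fun k _ => ?_
    have h₁ := (hmle' 0 k).mul_zpow hM (-1)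
    rw [zpow_neg_one] at h₁
    convert h₁ using 1
    have hf : f (N + 1) k = f 0 k + 1 := by
      simp only [f]
      rw [← Int.floor_add_one, hδ]
      push_cast
      congr 1
      field_simp
      ring
    simp only [x]
    rw [hf, mul_assoc, ← zpow_neg_one, ← zpow_add, neg_add]
  obtain ⟨i, hi⟩ := exists_chain_repetition hM hG hN m hmono hend
  refine ⟨m i, fun j l hl => ?_⟩
  -- Since m_i ≤ m_(i+1), compare m_i with the entry (i+1, j+k): its exponent exceeds that of (i, k)
  -- by at least l, because l ≤ jα + δ.
  have h₁ : GroupLeL ι ((g ^ j)⁻¹ * (m i * ι Δ ^ l)) (m i) := by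
    refine hmglb i _ fun k _ => ?_
    have h₂ := ((hi.trans (hmle' (i + 1) (j + k))).mul_zpow hM l).mul_left (g ^ j)⁻¹
    refine h₂.trans ?_
    simp only [x]
    rw [pow_add, mul_assoc, mul_assoc, inv_mul_cancel_left, ← zpow_add]
    refine (groupLeL_zpow_of_le ?_).mul_left _
    have h₃ : f i k + l ≤ f (i + 1) (j + k) := by
      simp only [f]
      rw [← Int.floor_add_intCast]
      apply Int.floor_le_floor
      push_cast
      linarith
    linarith
  have h₂ := h₁.mul_left ((m i)⁻¹ * g ^ j)
  convert h₂ using 1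
  group

/-! ### Translation numbers by superadditivity of `inf`, and conjugation. -/

theorem isGreatest_inf [Nontrivial G] (hG : IsGroupOfFractions ι) (h : G) :
    IsGreatest (lowerExponents ι Δ h) (inf ι Δ h) := by
  obtain ⟨s, hs⟩ := exists_groupLeL_zpow_right hM hG h
  obtain ⟨n, hn⟩ := exists_groupLeL_zpow hM hG h
  have hb : BddAbove (lowerExponents ι Δ h) :=
    ⟨s, fun r hr => le_of_groupLeL_zpow hM hG (GroupLeL.trans hr hs)⟩
  exact ⟨Int.csSup_mem ⟨_, hn⟩ hb, fun r hr => le_csSup hb hr⟩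

theorem zpow_inf_le [Nontrivial G] (hG : IsGroupOfFractions ι) (h : G) :
    GroupLeL ι (ι Δ ^ inf ι Δ h) h :=
  (isGreatest_inf hM hG h).1

theorem le_inf [Nontrivial G] (hG : IsGroupOfFractions ι) {h : G} {r : ℤ}
    (hr : GroupLeL ι (ι Δ ^ r) h) : r ≤ inf ι Δ h :=
  (isGreatest_inf hM hG h).2 hr

theorem inf_add_inf_le [Nontrivial G] (hG : IsGroupOfFractions ι) (x y : G) :
    inf ι Δ x + inf ι Δ y ≤ inf ι Δ (x * y) := by
  refine le_inf hM hG ?_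
  rw [zpow_add]
  exact ((zpow_inf_le hM hG x).mul_zpow hM _).trans ((zpow_inf_le hM hG y).mul_left x)

theorem subadditive_neg_inf [Nontrivial G] (hG : IsGroupOfFractions ι) (g : G) :
    Subadditive fun n : ℕ => -(inf ι Δ (g ^ n) : ℝ) := fun a b => by
  have h := inf_add_inf_le hM hG (g ^ a) (g ^ b)
  rw [← pow_add] at h
  have h' : (inf ι Δ (g ^ a) : ℝ) + inf ι Δ (g ^ b) ≤ inf ι Δ (g ^ (a + b)) := by
    exact_mod_cast h
  linarith

theorem bddBelow_neg_inf_div [Nontrivial G] (hG : IsGroupOfFractions ι) (g : G) :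
    BddBelow (Set.range fun n : ℕ => -(inf ι Δ (g ^ n) : ℝ) / n) := by
  obtain ⟨s, hs⟩ := exists_groupLeL_zpow_right hM hG g
  refine ⟨-s, ?_⟩
  rintro _ ⟨n, rfl⟩
  -- At n = 0 the quotient is 0 by convention, and -s ≤ 0 because s is a natural number.
  rcases Nat.eq_zero_or_pos n with rfl | hn
  · simp
  · have h := le_of_groupLeL_zpow hM hG ((zpow_inf_le hM hG (g ^ n)).trans (hs.pow_zpow hM n))
    have h' : (inf ι Δ (g ^ n) : ℝ) ≤ n * s := by exact_mod_cast h
    have hn' : (0 : ℝ) < n := by exact_mod_cast hn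
    simp only
    rw [le_div_iff₀ hn']
    linarith

theorem tendsto_tInf [Nontrivial G] (hG : IsGroupOfFractions ι) (g : G) :
    Filter.Tendsto (fun n : ℕ => (inf ι Δ (g ^ n) : ℝ) / (n : ℝ)) Filter.atTop
      (nhds (tInf ι Δ g)) := by
  have h := ((subadditive_neg_inf hM hG g).tendsto_lim (bddBelow_neg_inf_div hM hG g)).neg
  simp only [neg_div, neg_neg] at h
  exact tendsto_nhds_limUnder ⟨_, h⟩

theorem inf_pow_le [Nontrivial G] (hG : IsGroupOfFractions ι) (g : G) {n : ℕ} (hn : n ≠ 0) :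
    (inf ι Δ (g ^ n) : ℝ) ≤ n * tInf ι Δ g := by
  have hb := bddBelow_neg_inf_div hM hG g
  have h := ((subadditive_neg_inf hM hG g).tendsto_lim hb).neg
  simp only [neg_div, neg_neg] at h
  have ht := tendsto_nhds_unique (tendsto_tInf hM hG g) h
  have hle := (subadditive_neg_inf hM hG g).lim_le_div hb hn
  have hn' : (0 : ℝ) < n := by exact_mod_cast Nat.pos_of_ne_zero hn
  rw [le_div_iff₀ hn'] at hle
  rw [ht]
  linarith

/-- Conjugates of powers of `g` are bounded by `t_inf(g)`. -/
theorem le_mul_tInf_of_conj [Nontrivial G] (hG : IsGroupOfFractions ι) {g h : G} {j : ℕ}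
    (hj : j ≠ 0) {l : ℤ} (hl : GroupLeL ι (ι Δ ^ l) (h⁻¹ * g ^ j * h)) :
    (l : ℝ) ≤ j * tInf ι Δ g := by
  -- C bounds the cost of undoing the conjugation independently of n, so it vanishes after dividing
  -- by n.
  set C : ℤ := inf ι Δ h + inf ι Δ h⁻¹ with hC
  have key : ∀ n : ℕ, n ≠ 0 → (n : ℝ) * l + C ≤ n * (j * tInf ι Δ g) := fun n hn => by
    have h₁ := le_inf hM hG (hl.zpow_pow hM n)
    have h₂ := inf_add_inf_le hM hG h ((h⁻¹ * g ^ j * h) ^ n * h⁻¹)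
    have h₃ := inf_add_inf_le hM hG ((h⁻¹ * g ^ j * h) ^ n) h⁻¹
    have h₄ : h * ((h⁻¹ * g ^ j * h) ^ n * h⁻¹) = g ^ (j * n) := by
      rw [← mul_assoc, ← conj_pow, pow_mul]
      congr 1
      group
    rw [h₄] at h₂
    have h₅ := inf_pow_le hM hG g (Nat.mul_ne_zero hj hn)
    have h₆ : (n : ℤ) * l + C ≤ inf ι Δ (g ^ (j * n)) := by linarith
    have h₇ : (n : ℝ) * l + C ≤ inf ι Δ (g ^ (j * n)) := by exact_mod_cast h₆
    push_cast at h₅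
    linarith
  by_contra! hlt
  obtain ⟨n, hn⟩ := exists_nat_gt (-(C : ℝ) / (l - j * tInf ι Δ g))
  have hpos : 0 < (l : ℝ) - j * tInf ι Δ g := by linarith
  rw [div_lt_iff₀ hpos] at hn
  have := key (n + 1) n.succ_ne_zero
  push_cast at this
  linarith

/-- `1 / (N + 1)` can be gained over `j * t_inf(g)`, up to an arbitrarily small loss. -/
theorem exists_conj_zpow_le_of_lt [Nontrivial G] (hG : IsGroupOfFractions ι) {N : ℕ}
    (hN : atomNorm Δ = (N : ℕ∞)) (g : G) (j : ℕ) {l : ℤ}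
    (hl : (l : ℝ) < j * tInf ι Δ g + 1 / (N + 1)) :
    ∃ m : G, GroupLeL ι (ι Δ ^ l) (m⁻¹ * g ^ j * m) := by
  have ht := ((tendsto_tInf hM hG g).const_mul (j : ℝ)).add_const (1 / (N + 1) : ℝ)
  obtain ⟨n, hn, hn0⟩ :=
    ((ht.eventually (lt_mem_nhds hl)).and (Filter.eventually_gt_atTop 0)).exists
  obtain ⟨m, hm⟩ := exists_conj_zpow_le hM hG hN hn0 (zpow_inf_le hM hG (g ^ n))
  exact ⟨m, hm j l hn.le⟩

theorem isGreatest_conjInfs_floor [Nontrivial G] (hG : IsGroupOfFractions ι) {N : ℕ}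
    (hN : atomNorm Δ = (N : ℕ∞)) (g : G) {j : ℕ} (hj : j ≠ 0) :
    IsGreatest (conjInfs ι Δ (g ^ j)) ⌊j * tInf ι Δ g⌋ := by
  have hub : ∀ h : G, inf ι Δ (h⁻¹ * g ^ j * h) ≤ ⌊j * tInf ι Δ g⌋ := fun h =>
    Int.le_floor.2 (le_mul_tInf_of_conj hM hG hj (zpow_inf_le hM hG _))
  have hpos : (0 : ℝ) < 1 / (N + 1) := by positivity
  obtain ⟨m, hm⟩ := exists_conj_zpow_le_of_lt hM hG hN g j
    (lt_of_le_of_lt (Int.floor_le _) (lt_add_of_pos_right _ hpos))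
  refine ⟨⟨m, le_antisymm (hub m) (le_inf hM hG hm)⟩, ?_⟩
  rintro _ ⟨h, rfl⟩
  exact hub h

theorem infs_pow [Nontrivial G] (hG : IsGroupOfFractions ι) {N : ℕ}
    (hN : atomNorm Δ = (N : ℕ∞)) (g : G) {j : ℕ} (hj : j ≠ 0) :
    infs ι Δ (g ^ j) = ⌊j * tInf ι Δ g⌋ :=
  (isGreatest_conjInfs_floor hM hG hN g hj).csSup_eq

theorem isGreatest_infs [Nontrivial G] (hG : IsGroupOfFractions ι) {N : ℕ}
    (hN : atomNorm Δ = (N : ℕ∞)) (g : G) : IsGreatest (conjInfs ι Δ g) (infs ι Δ g) := by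
  have h := isGreatest_conjInfs_floor hM hG hN g one_ne_zero
  rw [← infs_pow hM hG hN g one_ne_zero, pow_one] at h
  exact h

/-! ### Rationality with bounded denominator. -/

omit hM in
/-- A real number with no denominator up to `N` has a positive multiple lying below an integer
at distance at most `1 / (N + 1)`. -/
theorem exists_mul_lt_int_le {N : ℕ} (hN : 0 < N) {t : ℝ}
    (ht : ∀ q : ℕ, 1 ≤ q → q ≤ N → ∀ p : ℤ, (q : ℝ) * t ≠ p) :
    ∃ (j : ℕ) (l : ℤ), j ≠ 0 ∧ (j : ℝ) * t < l ∧ (l : ℝ) ≤ j * t + 1 / (N + 1) := by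
  obtain ⟨p, k, hk0, hkN, hpk⟩ := Real.exists_int_int_abs_mul_sub_le t hN
  lift k to ℕ using hk0.le
  rw [Int.cast_natCast, abs_le] at hpk
  have hk : 1 ≤ k := by exact_mod_cast hk0
  rcases lt_or_gt_of_ne (ht k hk (by exact_mod_cast hkN) p) with hlt | hgt
  · exact ⟨k, p, by omega, hlt, by linarith [hpk.1]⟩
  -- Here kt overshoots p by ε ≤ 1/(N+1). With n the last integer such that nε < 1, nkt falls short
  -- of np + 1 by 1 - nε ≤ ε.
  · set ε : ℝ := k * t - p with hε
    have hεpos : 0 < ε := by linarith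
    have hN2 : (1 : ℝ) / (N + 1) < 1 := by
      have : (0 : ℝ) < N := by exact_mod_cast hN
      rw [div_lt_one (by positivity)]
      linarith
    obtain ⟨n, hn⟩ : ∃ n : ℕ, (n : ℝ) * ε < 1 ∧ 1 ≤ (n + 1 : ℝ) * ε := by
      have hex : ∃ n : ℕ, 1 ≤ (n + 1 : ℝ) * ε := by
        obtain ⟨n, hn⟩ := exists_nat_gt (1 / ε)
        rw [div_lt_iff₀ hεpos] at hn
        exact ⟨n, by linarith⟩
      classical
      refine ⟨Nat.find hex, ?_, Nat.find_spec hex⟩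
      rcases Nat.eq_zero_or_pos (Nat.find hex) with h0 | h0
      · rw [h0]
        simp
      · have := Nat.find_min hex (Nat.sub_lt h0 one_pos)
        rw [not_le] at this
        rwa [Nat.cast_pred h0, sub_add_cancel] at this
    have hn0 : n ≠ 0 := by
      rintro rfl
      simp only [Nat.cast_zero, zero_add, one_mul] at hn
      linarith [hn.2, hpk.2]
    refine ⟨n * k, n * p + 1, Nat.mul_ne_zero hn0 (by omega), ?_, ?_⟩
    · push_cast
      have : (n : ℝ) * k * t = n * p + n * ε := by rw [hε]; ring
      linarith [hn.1]
    · push_cast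
      have : (n : ℝ) * k * t = n * p + n * ε := by rw [hε]; ring
      linarith [hn.2, hpk.2]

/-- `t_inf(g)` is rational with a denominator at most `‖Δ‖`. -/
theorem exists_mul_tInf_eq_int [Nontrivial G] (hG : IsGroupOfFractions ι) {N : ℕ}
    (hN : atomNorm Δ = (N : ℕ∞)) (g : G) :
    ∃ (q : ℕ) (p : ℤ), 1 ≤ q ∧ q ≤ N ∧ (q : ℝ) * tInf ι Δ g = p := by
  by_contra! hcon
  have := hG.nontrivial
  obtain ⟨j, l, hj, hlt, hle⟩ := exists_mul_lt_int_le (hM.atomNorm_pos hN)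
    (fun q h₁ h₂ p => hcon q p h₁ h₂)
  suffices h : ∃ m : G, GroupLeL ι (ι Δ ^ l) (m⁻¹ * g ^ j * m) by
    obtain ⟨m, hm⟩ := h
    exact hlt.not_ge (le_mul_tInf_of_conj hM hG hj hm)
  rcases hle.lt_or_eq with hle' | heq
  · exact exists_conj_zpow_le_of_lt hM hG hN g j hle'
  -- At the endpoint no loss is affordable, but t is then rational with denominator j(N+1). Some
  -- conjugate of g attains the slope t exactly at that power, so the chain argument applies with α
  -- = t.
  · have hb : j * (N + 1) ≠ 0 := Nat.mul_ne_zero hj N.succ_ne_zero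
    have hj' : (j : ℝ) ≠ 0 := by exact_mod_cast hj
    have hN1 : (N + 1 : ℝ) ≠ 0 := by positivity
    have hbt : ((j * (N + 1) : ℕ) : ℝ) * tInf ι Δ g = (l * (N + 1) - 1 : ℤ) := by
      push_cast
      rw [heq]
      field_simp
      ring
    obtain ⟨⟨h, hh⟩, -⟩ := isGreatest_conjInfs_floor hM hG hN g hb
    rw [hbt, Int.floor_intCast] at hh
    have hconj : ∀ n : ℕ, h⁻¹ * g ^ n * h = (h⁻¹ * g * h) ^ n := fun n => by
      simpa using (conj_pow (a := h⁻¹) (b := g) (i := n)).symm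
    have hlow := zpow_inf_le hM hG (h⁻¹ * g ^ (j * (N + 1)) * h)
    simp only at hh
    rw [hh, hconj] at hlow
    obtain ⟨m, hm⟩ := exists_conj_zpow_le hM hG hN (Nat.pos_of_ne_zero hb) hlow
    refine ⟨h * m, ?_⟩
    have hm' := hm j l (by
      rw [← hbt, mul_div_cancel_left₀ _ (by exact_mod_cast hb)]
      exact hle)
    rw [← hconj] at hm'
    convert hm' using 1
    group

end Group

end Garside

/-- The first three clauses say that the maxima defining `inf` and `inf_s` and the limit
defining `t_inf` exist, so that `sSup` and `limUnder` take no default values. -/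
theorem theorem5p1 {M G : Type*} [Monoid M] [Group G] [Nontrivial G]
    (ι : M →* G) (Δ : M) (hM : Garside.IsGarsideMonoid Δ) (hG : Garside.IsGroupOfFractions ι)
    (N : ℕ) (hN : Garside.atomNorm Δ = (N : ℕ∞)) (g : G) :
    (∀ h : G, IsGreatest (Garside.lowerExponents ι Δ h) (Garside.inf ι Δ h)) ∧
    (∀ h : G, IsGreatest (Garside.conjInfs ι Δ h) (Garside.infs ι Δ h)) ∧
    Filter.Tendsto (fun n : ℕ => (Garside.inf ι Δ (g ^ n) : ℝ) / (n : ℝ)) Filter.atTop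
      (nhds (Garside.tInf ι Δ g)) ∧
    IsGreatest {x : ℝ | ∃ k : ℕ, 1 ≤ k ∧ k ≤ N ∧ x = (Garside.infs ι Δ (g ^ k) : ℝ) / (k : ℝ)}
      (Garside.tInf ι Δ g) ∧
    ∀ q : ℕ, 1 ≤ q → q ≤ N →
      ((∃ p : ℤ, Garside.tInf ι Δ g = (p : ℝ) / (q : ℝ)) ↔
        Garside.infs ι Δ (g ^ (q * N)) = (N : ℤ) * Garside.infs ι Δ (g ^ q)) ∧
      ∀ p : ℤ, Garside.tInf ι Δ g = (p : ℝ) / (q : ℝ) → p = Garside.infs ι Δ (g ^ q) := by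
  have hpow : ∀ j : ℕ, j ≠ 0 → Garside.infs ι Δ (g ^ j) = ⌊j * Garside.tInf ι Δ g⌋ :=
    fun j hj => Garside.infs_pow hM hG hN g hj
  obtain ⟨b, a, hb1, hbN, hba⟩ := Garside.exists_mul_tInf_eq_int hM hG hN g
  refine ⟨Garside.isGreatest_inf hM hG, Garside.isGreatest_infs hM hG hN,
    Garside.tendsto_tInf hM hG g, ⟨⟨b, hb1, hbN, ?_⟩, ?_⟩, fun q hq1 hqN => ?_⟩
  · have hb0 : (b : ℝ) ≠ 0 := by exact_mod_cast (by omega : b ≠ 0)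
    rw [hpow b (by omega), hba, Int.floor_intCast, ← hba, mul_div_cancel_left₀ _ hb0]
  · rintro _ ⟨k, hk1, -, rfl⟩
    have hk0 : (0 : ℝ) < k := by exact_mod_cast hk1
    rw [hpow k (by omega), div_le_iff₀ hk0, mul_comm (Garside.tInf ι Δ g)]
    exact Int.floor_le _
  · have hq0 : (q : ℝ) ≠ 0 := by exact_mod_cast (by omega : q ≠ 0)
    rw [hpow q (by omega), hpow (q * N) (Nat.mul_ne_zero (by omega) (by omega))]
    generalize Garside.tInf ι Δ g = t at hba
    have hmul : ∀ p : ℤ, t = (p : ℝ) / q ↔ (q : ℝ) * t = p := fun p => by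
      rw [eq_div_iff hq0, mul_comm]
    simp only [hmul]
    refine ⟨⟨?_, fun h => ⟨⌊(q : ℝ) * t⌋, ?_⟩⟩, fun p hp => by rw [hp, Int.floor_intCast]⟩
    · rintro ⟨p, hp⟩
      rw [hp, Int.floor_intCast, Nat.cast_mul, mul_right_comm, hp, mul_comm (p : ℝ)]
      exact_mod_cast Int.floor_intCast ((N : ℤ) * p)
    · set u : ℤ := ⌊(q : ℝ) * t⌋ with hu
      have h1 : (u : ℝ) ≤ q * t := Int.floor_le _
      have h2 : ((q * N : ℕ) : ℝ) * t < N * u + 1 := by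
        have := Int.lt_floor_add_one (((q * N : ℕ) : ℝ) * t)
        rw [h] at this
        exact_mod_cast this
      push_cast at h2
      have hb' : (b : ℝ) ≤ N := by exact_mod_cast hbN
      have hb0 : (0 : ℝ) < b := by exact_mod_cast hb1
      -- With t = a/b and b ≤ N, the number b(qt - u) is an integer in [0, 1), since N(qt - u) < 1;
      -- hence qt = u.
      have h3 : (b : ℝ) * (q * t - u) = ((q * a - b * u : ℤ) : ℝ) := by
        push_cast
        rw [← hba]
        ring
      have h4 : (b : ℝ) * (q * t - u) < 1 := by
        have := mul_le_mul_of_nonneg_right hb' (sub_nonneg.2 h1)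
        linarith
      have h5 : 0 ≤ (b : ℝ) * (q * t - u) := mul_nonneg hb0.le (sub_nonneg.2 h1)
      rw [h3] at h4 h5
      have h6 : (q * a - b * u : ℤ) = 0 := by
        have h7 : (q * a - b * u : ℤ) < 1 := by exact_mod_cast h4
        have h8 : (0 : ℤ) ≤ q * a - b * u := by exact_mod_cast h5
        omega
      rw [h6, Int.cast_zero] at h3
      rcases mul_eq_zero.1 h3 with h7 | h7
      · exact absurd h7 hb0.ne'
      · linarith
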